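/- A permutation of length $n$ is written in one-line notation as a word in $1,\dots,n$; all permutations are nonempty. A permutation $\pi$ contains $\sigma$ if some subsequence of $\pi$ is order isomorphic to $\sigma$, and $\operatorname{Av}(B)$ denotes the class of permutations containing no member of $B$. For a permutation $\sigma$ of length $k$ and nonempty permutations $\alpha_1,\dots,\alpha_k$, the inflation $\sigma[\alpha_1,\dots,\alpha_k]$ is the permutation of length $|\alpha_1|+\cdots+|\alpha_k|$ obtained by replacing each entry $\sigma(i)$ by an interval (a block of consecutive positions with consecutive values) order isomorphic to $\alpha_i$, so that the intervals are in the same relative order as the entries of $\sigma$. Write $\alpha\oplus\beta=12[\alpha,\beta]$ and $\alpha\ominus\beta=21[\alpha,\beta]$. A permutation belongs to $\operatorname{Av}(2431,3142,3241)$ if and only if it is the permutation $1$ or has at least one of the following forms: (a) $\pi\oplus\sigma$ where $\pi,\sigma\in\operatorname{Av}(2431,3142,3241)$; (b) $\pi\ominus\sigma$ where $\pi\in\operatorname{Av}(132,213)$ and $\sigma\in\operatorname{Av}(2431,3142,3241)$; (c) an inflation of a parallel alternation $2\,4\,6\cdots(2m)\,1\,3\,5\cdots(2m-1)$ with $m\ge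 2$, in which each even entry is inflated by an increasing permutation and each odd entry is inflated by a member of $\operatorname{Av}(2431,3142,3241)$. -/

import Mathlib

namespace PermPattern

/-- A permutation of arbitrary finite length. Positions and values are counted from `0`, so the
one-line notation `2431` is written `![1, 3, 2, 0]`. -/
structure FinPerm where
  len : ℕ
  perm : Equiv.Perm (Fin len)

/-- `σ` is contained in `π` as a pattern: some subsequence of `π` is order isomorphic to `σ`. -/
def Contains (π σ : FinPerm) : Prop :=
  ∃ f : Fin σ.len → Fin π.len, StrictMono f ∧
    ∀ i j, σ.perm i < σ.perm j ↔ π.perm (f i) < π.perm (f j)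

/-- The class of all permutations that contain no member of `B`. -/
def Av (B : Set FinPerm) : Set FinPerm :=
  {π | ∀ β ∈ B, ¬ Contains π β}

/-- The permutation `12`. -/
def p12 : FinPerm := ⟨2, 1⟩

/-- The permutation `21`. -/
def p21 : FinPerm := ⟨2, ![1, 0], ![1, 0], by decide, by decide⟩

/-- The permutation `132`. -/
def p132 : FinPerm := ⟨3, ![0, 2, 1], ![0, 2, 1], by decide, by decide⟩

/-- The permutation `213`. -/
def p213 : FinPerm := ⟨3, ![1, 0, 2], ![1, 0, 2], by decide, by decide⟩

/-- The permutation `2431`. -/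
def p2431 : FinPerm := ⟨4, ![1, 3, 2, 0], ![3, 0, 2, 1], by decide, by decide⟩

/-- The permutation `3142`. -/
def p3142 : FinPerm := ⟨4, ![2, 0, 3, 1], ![1, 3, 0, 2], by decide, by decide⟩

/-- The permutation `3241`. -/
def p3241 : FinPerm := ⟨4, ![2, 1, 3, 0], ![3, 1, 0, 2], by decide, by decide⟩

/-- The permutation is increasing, that is, of the form `12⋯n`. -/
def IsIncreasing (π : FinPerm) : Prop := StrictMono π.perm

/-- `π` is the inflation `σ[α₁, …, αₘ]` of `σ` by the nonempty permutations `αᵢ`. Here `f i a` is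
the position in `π` of the `a`-th entry of the block that replaces the `i`-th entry of `σ`. The
blocks exhaust `π`, each one is order isomorphic to the corresponding `αᵢ`, they come from left
to right in the order of the entries of `σ`, and the values in different blocks compare as the
entries of `σ` do. -/
def IsInflation (π σ : FinPerm) (α : Fin σ.len → FinPerm) : Prop :=
  (∀ i, 0 < (α i).len) ∧
  ∃ f : (i : Fin σ.len) → Fin (α i).len → Fin π.len,
    (∀ p, ∃ i a, f i a = p) ∧
    (∀ i, StrictMono (f i)) ∧
    (∀ i a b, (α i).perm a < (α i).perm b ↔ π.perm (f i a) < π.perm (f i b)) ∧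
    (∀ i j a b, i < j → f i a < f j b) ∧
    (∀ i j a b, σ.perm i < σ.perm j → π.perm (f i a) < π.perm (f j b))

/-- `π = σ ⊕ τ`, that is, `π = 12[σ, τ]`. -/
def IsDirectSum (π σ τ : FinPerm) : Prop := IsInflation π p12 ![σ, τ]

/-- `π = σ ⊖ τ`, that is, `π = 21[σ, τ]`. -/
def IsSkewSum (π σ τ : FinPerm) : Prop := IsInflation π p21 ![σ, τ]

/-- The parallel alternation `246⋯(2m)135⋯(2m-1)`, of length `2m`. -/
def parallelAlternation (m : ℕ) : FinPerm where
  len := 2 * m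
  perm :=
    { toFun := fun i =>
        if h : (i : ℕ) < m then ⟨2 * i + 1, by omega⟩ else ⟨2 * (i - m), by omega⟩
      invFun := fun v =>
        if h : (v : ℕ) % 2 = 1 then ⟨v / 2, by omega⟩ else ⟨m + v / 2, by omega⟩
      left_inv := by
        intro i
        by_cases h : (i : ℕ) < m
        · have h1 : (2 * (i : ℕ) + 1) % 2 = 1 := by omega
          simp only [h, dif_pos, h1]
          apply Fin.ext
          simp only
          omega
        · have h1 : ¬ (2 * ((i : ℕ) - m)) % 2 = 1 := by omega
          simp only [h, dif_neg, not_false_eq_true, h1]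
          apply Fin.ext
          simp only
          omega
      right_inv := by
        intro v
        by_cases h : (v : ℕ) % 2 = 1
        · have h1 : (v : ℕ) / 2 < m := by omega
          simp only [h, dif_pos, h1]
          apply Fin.ext
          simp only
          omega
        · have h1 : ¬ m + (v : ℕ) / 2 < m := by omega
          simp only [h, dif_neg, not_false_eq_true, h1]
          apply Fin.ext
          simp only
          omega }

end PermPattern

namespace PermPattern

/-! Necessity: look at the maximum, at position `M`. If it comes last, it splits off as a direct
summand. Otherwise suppose there is an inversion among the positions up to `M`. Avoiding 3241 and
3142 forces the upper entry of any such inversion below everything after `M`, and this yields a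
direct sum cut (`exists_isDirectSum_of_inversion`). If instead the entries up to `M` increase, send
each later position `q` to the first position `r q` whose entry exceeds that of `q`. Avoiding 2431
makes `r` weakly increasing. If `r` never takes the value 0, the first entry is the minimum and
splits off; if it is always 0, there is a skew sum with increasing left part. Otherwise the values
of `r` cut the initial run, and its fibres cut the rest, into the blocks of a parallel alternation
(`exists_isInflation_parallelAlternation`). All components are patterns of the permutation, hence
stay in the class. Sufficiency: in each form, an occurrence of a forbidden pattern is trapped in a
single block, or its first three entries are trapped in the left skew summand. -/

/-! ### Pattern containment. -/

theorem Contains.trans {π ρ β : FinPerm} (h : Contains π ρ) (h' : Contains ρ β) :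
    Contains π β := by
  obtain ⟨f, hf, hf'⟩ := h
  obtain ⟨g, hg, hg'⟩ := h'
  exact ⟨f ∘ g, hf.comp hg, fun i j => (hg' i j).trans (hf' _ _)⟩

theorem mem_Av_of_contains {B : Set FinPerm} {π ρ : FinPerm} (hπ : π ∈ Av B)
    (h : Contains π ρ) : ρ ∈ Av B :=
  fun β hβ h' => hπ β hβ (h.trans h')

/-- Values are totally ordered and distinct, so preserving strict inequalities already reflects
them. -/
theorem contains_of_lt_imp {π σ : FinPerm} (f : Fin σ.len → Fin π.len) (hf : StrictMono f)
    (h : ∀ i j, σ.perm i < σ.perm j → π.perm (f i) < π.perm (f j)) : Contains π σ := by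
  refine ⟨f, hf, fun i j => ⟨h i j, fun hij => ?_⟩⟩
  rcases lt_trichotomy (σ.perm i) (σ.perm j) with h1 | h1 | h1
  · exact h1
  · rw [σ.perm.injective h1] at hij
    exact absurd hij (lt_irrefl _)
  · exact absurd (h _ _ h1) hij.not_gt

theorem contains_p2431 {π : FinPerm} {a b c d : Fin π.len} (hab : a < b) (hbc : b < c)
    (hcd : c < d) (h1 : π.perm d < π.perm a) (h2 : π.perm a < π.perm c)
    (h3 : π.perm c < π.perm b) : Contains π p2431 := by
  refine contains_of_lt_imp (σ := p2431) (![a, b, c, d] : Fin 4 → Fin π.len) ?_ ?_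
  · refine (Fin.strictMono_iff_lt_succ (n := 3)).2 fun i => ?_
    fin_cases i <;> simpa
  · have h4 := h1.trans h2
    have h5 := h2.trans h3
    have h6 := h4.trans h3
    intro (i : Fin 4) (j : Fin 4)
    fin_cases i <;> fin_cases j <;> first | (intro; assumption) | (intro h; exact absurd h (by decide))

theorem contains_p3142 {π : FinPerm} {a b c d : Fin π.len} (hab : a < b) (hbc : b < c)
    (hcd : c < d) (h1 : π.perm b < π.perm d) (h2 : π.perm d < π.perm a)
    (h3 : π.perm a < π.perm c) : Contains π p3142 := by
  refine contains_of_lt_imp (σ := p3142) (![a, b, c, d] : Fin 4 → Fin π.len) ?_ ?_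
  · refine (Fin.strictMono_iff_lt_succ (n := 3)).2 fun i => ?_
    fin_cases i <;> simpa
  · have h4 := h1.trans h2
    have h5 := h2.trans h3
    have h6 := h4.trans h3
    intro (i : Fin 4) (j : Fin 4)
    fin_cases i <;> fin_cases j <;> first | (intro; assumption) | (intro h; exact absurd h (by decide))

theorem contains_p3241 {π : FinPerm} {a b c d : Fin π.len} (hab : a < b) (hbc : b < c)
    (hcd : c < d) (h1 : π.perm d < π.perm b) (h2 : π.perm b < π.perm a)
    (h3 : π.perm a < π.perm c) : Contains π p3241 := by
  refine contains_of_lt_imp (σ := p3241) (![a, b, c, d] : Fin 4 → Fin π.len) ?_ ?_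
  · refine (Fin.strictMono_iff_lt_succ (n := 3)).2 fun i => ?_
    fin_cases i <;> simpa
  · have h4 := h1.trans h2
    have h5 := h2.trans h3
    have h6 := h4.trans h3
    intro (i : Fin 4) (j : Fin 4)
    fin_cases i <;> fin_cases j <;> first | (intro; assumption) | (intro h; exact absurd h (by decide))

/-! ### Inflations as block maps. -/

/-- An inflation comes with a map sending each position to the block containing it. -/
theorem IsInflation.exists_block {π σ : FinPerm} {α : Fin σ.len → FinPerm}
    (h : IsInflation π σ α) :
    ∃ c : Fin π.len → Fin σ.len,
      (∀ p q, p ≤ q → c p ≤ c q) ∧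
      (∀ p q, π.perm p ≤ π.perm q → σ.perm (c p) ≤ σ.perm (c q)) ∧
      (∀ ρ (e : Fin ρ.len → Fin π.len), StrictMono e →
        (∀ x y, ρ.perm x < ρ.perm y ↔ π.perm (e x) < π.perm (e y)) →
        ∀ a b, (∀ x, a ≤ x ∧ x ≤ b) → c (e a) = c (e b) → Contains (α (c (e a))) ρ) ∧
      (∀ i, IsIncreasing (α i) → ∀ p q, p < q → c p = i → c q = i → π.perm p < π.perm q) := by
  obtain ⟨-, f, hsurj, hmono, hord, hpos, hval⟩ := h
  choose c g hg using hsurj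
  have hc_mono : ∀ p q, p ≤ q → c p ≤ c q := fun p q hpq => by
    by_contra! hlt
    have := hpos _ _ (g q) (g p) hlt
    rw [hg, hg] at this
    exact absurd this hpq.not_gt
  refine ⟨c, hc_mono, fun p q hpq => ?_, fun ρ e he hρ u v huv hc => ?_,
    fun i hi p q hpq hp hq => ?_⟩
  · by_contra! hlt
    have := hval _ _ (g q) (g p) hlt
    rw [hg, hg] at this
    exact absurd this hpq.not_gt
  -- Blocks are intervals of positions, so equal blocks at the two ends trap the whole occurrence.
  · have hg' : ∀ x, ∃ a, f (c (e u)) a = e x := fun x => by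
      have hx : c (e x) = c (e u) :=
        le_antisymm (hc ▸ hc_mono _ _ (he.monotone (huv x).2))
          (hc_mono _ _ (he.monotone (huv x).1))
      rw [← hx]
      exact ⟨_, hg _⟩
    choose k hk using hg'
    refine ⟨k, fun x y hxy => ?_, fun x y => ?_⟩
    · rw [← (hmono _).lt_iff_lt, hk, hk]
      exact he hxy
    · rw [hρ, hord, hk, hk]
  · subst hp
    obtain ⟨b, hb⟩ : ∃ b, f (c p) b = q := by
      rw [← hq]
      exact ⟨_, hg _⟩
    have hlt : g p < b := by
      rw [← (hmono (c p)).lt_iff_lt, hg, hb]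
      exact hpq
    have := (hord _ _ _).1 (hi hlt)
    rwa [hg, hb] at this

/-- The permutation order isomorphic to the entries of `π` in the positions `S`. -/
def restrict (π : FinPerm) (S : Finset (Fin π.len)) : FinPerm where
  len := S.card
  perm := ((S.orderIsoOfFin rfl).toEquiv.trans
    (π.perm.subtypeEquiv (q := fun v => v ∈ S.map π.perm.toEmbedding) (by simp))).trans
      ((S.map π.perm.toEmbedding).orderIsoOfFin (S.card_map _)).symm.toEquiv

/-- The inclusion of the positions of `restrict π S` into those of `π`. -/
def restrictEmb (π : FinPerm) (S : Finset (Fin π.len)) : Fin (restrict π S).len → Fin π.len :=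
  S.orderEmbOfFin rfl

theorem restrictEmb_strictMono (π : FinPerm) (S : Finset (Fin π.len)) :
    StrictMono (restrictEmb π S) :=
  (S.orderEmbOfFin rfl).strictMono

theorem restrictEmb_mem (π : FinPerm) (S : Finset (Fin π.len)) (a : Fin (restrict π S).len) :
    restrictEmb π S a ∈ S :=
  S.orderEmbOfFin_mem rfl a

theorem exists_restrictEmb_eq {π : FinPerm} {S : Finset (Fin π.len)} {p : Fin π.len}
    (hp : p ∈ S) : ∃ a, restrictEmb π S a = p := by
  have : p ∈ Set.range (S.orderEmbOfFin rfl) := by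
    rwa [Finset.range_orderEmbOfFin]
  exact this

theorem restrict_perm_lt_iff (π : FinPerm) (S : Finset (Fin π.len))
    (a b : Fin (restrict π S).len) :
    (restrict π S).perm a < (restrict π S).perm b ↔
      π.perm (restrictEmb π S a) < π.perm (restrictEmb π S b) := by
  change ((S.map π.perm.toEmbedding).orderIsoOfFin (S.card_map _)).symm _ <
    ((S.map π.perm.toEmbedding).orderIsoOfFin (S.card_map _)).symm _ ↔ _
  rw [OrderIso.lt_iff_lt]
  rfl

theorem contains_restrict (π : FinPerm) (S : Finset (Fin π.len)) : Contains π (restrict π S) :=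
  ⟨restrictEmb π S, restrictEmb_strictMono π S, restrict_perm_lt_iff π S⟩

/-- A compatible block map exhibits `π` as an inflation. -/
theorem exists_isInflation {π σ : FinPerm} (c : Fin π.len → Fin σ.len)
    (hc : Function.Surjective c) (hmono : ∀ p q, p < q → c p ≤ c q)
    (hval : ∀ p q, σ.perm (c p) < σ.perm (c q) → π.perm p < π.perm q) :
    ∃ α : Fin σ.len → FinPerm, IsInflation π σ α ∧ (∀ i, Contains π (α i)) ∧
      ∀ i, (∀ p q, p < q → c p = i → c q = i → π.perm p < π.perm q) → IsIncreasing (α i) := by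
  obtain ⟨S, hS⟩ : ∃ S : Fin σ.len → Finset (Fin π.len), ∀ i p, p ∈ S i ↔ c p = i :=
    ⟨fun i => Finset.univ.filter (c · = i), fun i p => by simp⟩
  have hS' : ∀ i a, c (restrictEmb π (S i) a) = i := fun i a =>
    (hS _ _).1 (restrictEmb_mem π (S i) a)
  refine ⟨fun i => restrict π (S i), ⟨fun i => ?_, fun i => restrictEmb π (S i),
    fun p => ⟨c p, exists_restrictEmb_eq ((hS _ _).2 rfl)⟩,
    fun i => restrictEmb_strictMono π (S i), fun i => restrict_perm_lt_iff π (S i),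
    fun i j a b hij => ?_, fun i j a b hij => hval _ _ ?_⟩, fun i => contains_restrict π _,
    fun i hi a b hab => (restrict_perm_lt_iff π (S i) a b).2
      (hi _ _ (restrictEmb_strictMono π _ hab) (hS' i a) (hS' i b))⟩
  · obtain ⟨p, hp⟩ := hc i
    exact Finset.card_pos.2 ⟨p, (hS _ _).2 hp⟩
  · by_contra! hle
    have h1 : c (restrictEmb π (S j) b) ≤ c (restrictEmb π (S i) a) := by
      rcases hle.eq_or_lt with h | h
      · exact (congrArg c h).le
      · exact hmono _ _ h
    rw [hS', hS'] at h1
    exact absurd hij h1.not_gt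
  · change σ.perm (c (restrictEmb π (S i) a)) < σ.perm (c (restrictEmb π (S j) b))
    rwa [hS', hS']

theorem exists_isDirectSum {π : FinPerm} (t : ℕ) (h0 : 0 < t) (ht : t < π.len)
    (h : ∀ p q : Fin π.len, (p : ℕ) < t → t ≤ (q : ℕ) → π.perm p < π.perm q) :
    ∃ σ τ, Contains π σ ∧ Contains π τ ∧ IsDirectSum π σ τ := by
  let c : Fin π.len → Fin 2 := fun p => if (p : ℕ) < t then 0 else 1
  have hc1 : ∀ p : Fin π.len, (p : ℕ) < t → c p = 0 := fun p hp => if_pos hp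
  have hc2 : ∀ p : Fin π.len, t ≤ (p : ℕ) → c p = 1 := fun p hp => if_neg hp.not_gt
  obtain ⟨α, hα, hα', -⟩ := exists_isInflation (π := π) (σ := p12) c
    (fun (i : Fin 2) => by
      fin_cases i
      · exact ⟨⟨0, h0.trans ht⟩, hc1 _ h0⟩
      · exact ⟨⟨t, ht⟩, hc2 _ le_rfl⟩)
    (fun p q hpq => by
      rcases lt_or_ge (q : ℕ) t with hq | hq
      · have hp : (p : ℕ) < t := lt_trans hpq hq
        exact ((hc1 p hp).trans (hc1 q hq).symm).le
      · rw [hc2 q hq]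
        exact Fin.le_last (n := 1) (c p))
    (fun p q hpq => by
      rcases lt_or_ge (p : ℕ) t with hp | hp <;> rcases lt_or_ge (q : ℕ) t with hq | hq
      · rw [hc1 p hp, hc1 q hq] at hpq
        exact absurd hpq (lt_irrefl _)
      · exact h p q hp hq
      · rw [hc2 p hp, hc1 q hq] at hpq
        exact absurd hpq (by decide)
      · rw [hc2 p hp, hc2 q hq] at hpq
        exact absurd hpq (lt_irrefl _))
  refine ⟨α (0 : Fin 2), α (1 : Fin 2), hα' _, hα' _, ?_⟩
  have : α = ![α (0 : Fin 2), α (1 : Fin 2)] := by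
    funext (i : Fin 2)
    fin_cases i <;> rfl
  unfold IsDirectSum
  rwa [← this]

theorem exists_isSkewSum {π : FinPerm} (t : ℕ) (h0 : 0 < t) (ht : t < π.len)
    (h : ∀ p q : Fin π.len, (p : ℕ) < t → t ≤ (q : ℕ) → π.perm q < π.perm p)
    (hinc : ∀ p q : Fin π.len, p < q → (q : ℕ) < t → π.perm p < π.perm q) :
    ∃ σ τ, IsIncreasing σ ∧ Contains π τ ∧ IsSkewSum π σ τ := by
  let c : Fin π.len → Fin 2 := fun p => if (p : ℕ) < t then 0 else 1
  have hc1 : ∀ p : Fin π.len, (p : ℕ) < t → c p = 0 := fun p hp => if_pos hp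
  have hc2 : ∀ p : Fin π.len, t ≤ (p : ℕ) → c p = 1 := fun p hp => if_neg hp.not_gt
  obtain ⟨α, hα, hα', hα''⟩ := exists_isInflation (π := π) (σ := p21) c
    (fun (i : Fin 2) => by
      fin_cases i
      · exact ⟨⟨0, h0.trans ht⟩, hc1 _ h0⟩
      · exact ⟨⟨t, ht⟩, hc2 _ le_rfl⟩)
    (fun p q hpq => by
      rcases lt_or_ge (q : ℕ) t with hq | hq
      · have hp : (p : ℕ) < t := lt_trans hpq hq
        exact ((hc1 p hp).trans (hc1 q hq).symm).le
      · rw [hc2 q hq]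
        exact Fin.le_last (n := 1) (c p))
    (fun p q hpq => by
      rcases lt_or_ge (p : ℕ) t with hp | hp <;> rcases lt_or_ge (q : ℕ) t with hq | hq
      · rw [hc1 p hp, hc1 q hq] at hpq
        exact absurd hpq (lt_irrefl _)
      · rw [hc1 p hp, hc2 q hq] at hpq
        exact absurd hpq (by decide)
      · exact h q p hq hp
      · rw [hc2 p hp, hc2 q hq] at hpq
        exact absurd hpq (lt_irrefl _))
  refine ⟨α (0 : Fin 2), α (1 : Fin 2), hα'' _ fun p q hpq _ hq => hinc p q hpq ?_, hα' _, ?_⟩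
  · by_contra! hq'
    exact absurd ((hc2 q hq').symm.trans hq) (by decide)
  have : α = ![α (0 : Fin 2), α (1 : Fin 2)] := by
    funext (i : Fin 2)
    fin_cases i <;> rfl
  unfold IsSkewSum
  rwa [← this]

/-- The decomposition only ever produces increasing left skew summands; this places them in the
wider class allowed by form (b). -/
theorem IsIncreasing.mem_Av {σ : FinPerm} (h : IsIncreasing σ) : σ ∈ Av {p132, p213} := by
  rintro β (rfl | rfl) ⟨f, hf, hf'⟩
  · have h1 : f (1 : Fin 3) < f (2 : Fin 3) := hf (by decide)
    exact absurd ((hf' (2 : Fin 3) (1 : Fin 3)).1 (by decide)) (h h1).not_gt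
  · have h1 : f (0 : Fin 3) < f (1 : Fin 3) := hf (by decide)
    exact absurd ((hf' (1 : Fin 3) (0 : Fin 3)).1 (by decide)) (h h1).not_gt

/-! ### Each of the three forms lies in the class. -/

theorem parallelAlternation_perm_of_lt {m : ℕ} {i : Fin (parallelAlternation m).len}
    (h : (i : ℕ) < m) : ((parallelAlternation m).perm i : ℕ) = 2 * i + 1 := by
  exact congrArg Fin.val (dif_pos h)

theorem parallelAlternation_perm_of_le {m : ℕ} {i : Fin (parallelAlternation m).len}
    (h : m ≤ (i : ℕ)) : ((parallelAlternation m).perm i : ℕ) = 2 * (i - m) := by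
  exact congrArg Fin.val (dif_neg h.not_gt)

/-- The `+ 1` turns values counted from 0 into one-line entries. -/
theorem even_parallelAlternation_iff {m : ℕ} (i : Fin (parallelAlternation m).len) :
    Even (((parallelAlternation m).perm i : ℕ) + 1) ↔ (i : ℕ) < m := by
  rcases lt_or_ge (i : ℕ) m with h | h
  · rw [parallelAlternation_perm_of_lt h, Nat.even_iff]
    omega
  · rw [parallelAlternation_perm_of_le h, Nat.even_iff]
    omega

/-- Each forbidden pattern starts above its last entry, and an inversion cannot straddle a direct
sum. -/
theorem mem_Av_of_isDirectSum {π σ τ : FinPerm} (hσ : σ ∈ Av {p2431, p3142, p3241})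
    (hτ : τ ∈ Av {p2431, p3142, p3241}) (h : IsDirectSum π σ τ) :
    π ∈ Av {p2431, p3142, p3241} := by
  obtain ⟨c, hmono, hval, hblock, -⟩ := h.exists_block
  have key : ∀ p q, p ≤ q → π.perm q < π.perm p → c p = c q := fun p q hpq h' =>
    le_antisymm (hmono _ _ hpq) (hval _ _ h'.le)
  have hα : ∀ i : Fin 2, (![σ, τ] : Fin 2 → FinPerm) i ∈ Av {p2431, p3142, p3241} := by
    intro i
    fin_cases i
    exacts [hσ, hτ]
  intro β hβ ⟨e, he, he'⟩
  have aux := hblock β e he he'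
  have hα' := fun i => hα i β hβ
  rcases hβ with rfl | rfl | rfl <;>
  exact hα' _ (aux (0 : Fin 4) (3 : Fin 4) (by decide)
    (key _ _ (he.monotone (by decide)) ((he' (3 : Fin 4) (0 : Fin 4)).1 (by decide))))

/-- Each forbidden pattern begins with 132 or 213, whose first entry is below its third. If the
third entry lies in the left block, so do the first three; if it lies in the right block, the ascent
drags the first entry there and the whole pattern follows. -/
theorem mem_Av_of_isSkewSum {π σ τ : FinPerm} (hσ : σ ∈ Av {p132, p213})
    (hτ : τ ∈ Av {p2431, p3142, p3241}) (h : IsSkewSum π σ τ) :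
    π ∈ Av {p2431, p3142, p3241} := by
  obtain ⟨c, hmono, hval, hblock, -⟩ := h.exists_block
  change Fin π.len → Fin 2 at c
  have h01 : ∀ i : Fin 2, i = 0 ∨ i = 1 := by decide
  have hup : ∀ p q, π.perm p < π.perm q → c q = 1 → c p = 1 := fun p q hpq hq => by
    rcases h01 (c p) with hp | hp
    · have := hval _ _ hpq.le
      rw [hp, hq] at this
      exact absurd this (by decide)
    · exact hp
  have hright : ∀ p q, p ≤ q → c p = 1 → c q = 1 := fun p q hpq hp =>
    le_antisymm (Fin.le_last (n := 1) _) (hp ▸ hmono _ _ hpq)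
  have hleft : ∀ p q, p ≤ q → c q = 0 → c p = 0 := fun p q hpq hq =>
    le_antisymm (hq ▸ hmono _ _ hpq) (Fin.zero_le _)
  have hcase : ∀ β ∈ ({p2431, p3142, p3241} : Set FinPerm), ∀ ρ ∈ ({p132, p213} : Set FinPerm),
      ∀ e : Fin β.len → Fin π.len, StrictMono e →
      (∀ x y, β.perm x < β.perm y ↔ π.perm (e x) < π.perm (e y)) →
      ∀ u v w : Fin β.len, (∀ x, u ≤ x ∧ x ≤ w) → v ≤ w → β.perm u < β.perm v →
      ∀ g : Fin ρ.len → Fin β.len, StrictMono g →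
      (∀ x y, ρ.perm x < ρ.perm y ↔ β.perm (g x) < β.perm (g y)) →
      ∀ r t, (∀ x, r ≤ x ∧ x ≤ t) → g r = u → g t = v → False := by
    intro β hβ ρ hρ e he he' u v w huw hvw huv g hg hg' r t hrt hr ht
    rcases h01 (c (e v)) with hv | hv
    · have hu := hleft _ _ (he.monotone (huw v).1) hv
      have := hblock ρ (e ∘ g) (he.comp hg) (fun x y => (hg' x y).trans (he' _ _)) r t hrt
      simp only [Function.comp, hr, ht, hu, hv] at this
      exact hσ ρ hρ (this rfl)
    · have hu := hup _ _ ((he' _ _).1 huv) hv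
      have := hblock β e he he' u w huw
      rw [hu, hright _ _ (he.monotone hvw) hv] at this
      exact hτ β hβ (this rfl)
  intro β hβ ⟨e, he, he'⟩
  have hg : StrictMono (![0, 1, 2] : Fin 3 → Fin 4) := by decide
  have aux := hcase β hβ
  rcases hβ with rfl | rfl | rfl
  · exact aux p132 (by simp) e he he' (0 : Fin 4) (2 : Fin 4) (3 : Fin 4) (by decide) (by decide)
      (by decide) (![0, 1, 2] : Fin 3 → Fin 4) hg (by decide) (0 : Fin 3) (2 : Fin 3)
      (by decide) rfl rfl
  · exact aux p213 (by simp) e he he' (0 : Fin 4) (2 : Fin 4) (3 : Fin 4) (by decide) (by decide)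
      (by decide) (![0, 1, 2] : Fin 3 → Fin 4) hg (by decide) (0 : Fin 3) (2 : Fin 3)
      (by decide) rfl rfl
  · exact aux p213 (by simp) e he he' (0 : Fin 4) (2 : Fin 4) (3 : Fin 4) (by decide) (by decide)
      (by decide) (![0, 1, 2] : Fin 3 → Fin 4) hg (by decide) (0 : Fin 3) (2 : Fin 3)
      (by decide) rfl rfl

/-- The left half is increasing, so the lower entry of any inversion lies in the right half. Each
forbidden pattern has a descent within its first three entries, so its last two lie in the right
half; being a descent, they share a block. The first entry has a value between theirs, so it joins
that block, and everything between first and last does too. -/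
theorem mem_Av_of_isInflation_parallelAlternation {π : FinPerm} {m : ℕ}
    {α : Fin (parallelAlternation m).len → FinPerm}
    (hinc : ∀ i, Even (((parallelAlternation m).perm i : ℕ) + 1) → IsIncreasing (α i))
    (hAv : ∀ i, Odd (((parallelAlternation m).perm i : ℕ) + 1) →
      α i ∈ Av {p2431, p3142, p3241})
    (h : IsInflation π (parallelAlternation m) α) : π ∈ Av {p2431, p3142, p3241} := by
  obtain ⟨c, hmono, hval, hblock, hincr⟩ := h.exists_block
  have hAv' : ∀ i : Fin (parallelAlternation m).len, m ≤ (i : ℕ) →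
      α i ∈ Av {p2431, p3142, p3241} := fun i hi =>
    hAv i (by rw [← Nat.not_even_iff_odd, even_parallelAlternation_iff]; exact hi.not_gt)
  have hval' : ∀ p q, π.perm p < π.perm q →
      ((parallelAlternation m).perm (c p) : ℕ) ≤ (parallelAlternation m).perm (c q) :=
    fun p q hpq => hval _ _ hpq.le
  have hup : ∀ p q, p < q → π.perm q < π.perm p → m ≤ (c q : ℕ) := fun p q hpq hlt => by
    by_contra! hq
    have hle : (c p : ℕ) ≤ c q := hmono _ _ hpq.le
    have := hval' _ _ hlt
    rw [parallelAlternation_perm_of_lt hq, parallelAlternation_perm_of_lt (hle.trans_lt hq)] at this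
    have hpq' : c p = c q := Fin.ext (by omega)
    exact absurd (hincr _ (hinc _ ((even_parallelAlternation_iff _).2 hq)) p q hpq hpq' rfl)
      hlt.not_gt
  have hright : ∀ p q, p < q → m ≤ (c p : ℕ) → m ≤ (c q : ℕ) := fun p q hpq hp =>
    hp.trans (hmono _ _ hpq.le)
  have hblk : ∀ p q, p < q → m ≤ (c p : ℕ) → π.perm q < π.perm p → c p = c q :=
    fun p q hpq hp hlt => by
    have hle : (c p : ℕ) ≤ c q := hmono _ _ hpq.le
    have := hval' _ _ hlt
    rw [parallelAlternation_perm_of_le hp, parallelAlternation_perm_of_le (hp.trans hle)] at this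
    exact Fin.ext (by omega)
  have hmid : ∀ p q r, c p = c q → π.perm q < π.perm r → π.perm r < π.perm p → c r = c q :=
    fun p q r hpq h1 h2 => by
    refine (parallelAlternation m).perm.injective (le_antisymm ?_ (hval _ _ h1.le))
    rw [← hpq]
    exact hval _ _ h2.le
  intro β hβ ⟨e, he, he'⟩
  have aux := hblock β e he he'
  have hAv'' := fun i hi => hAv' i hi β hβ
  rcases hβ with rfl | rfl | rfl
  all_goals
    have l01 : e (0 : Fin 4) < e (1 : Fin 4) := he (by decide)
    have l12 : e (1 : Fin 4) < e (2 : Fin 4) := he (by decide)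
    have l23 : e (2 : Fin 4) < e (3 : Fin 4) := he (by decide)
    have aux' := aux (0 : Fin 4) (3 : Fin 4) (by decide)
  · have h2 := hup _ _ l12 ((he' (2 : Fin 4) (1 : Fin 4)).1 (by decide))
    have hd : π.perm (e (3 : Fin 4)) < π.perm (e (2 : Fin 4)) :=
      (he' (3 : Fin 4) (2 : Fin 4)).1 (by decide)
    have h03 := hmid _ _ (e (0 : Fin 4)) (hblk _ _ l23 h2 hd)
      ((he' (3 : Fin 4) (0 : Fin 4)).1 (by decide)) ((he' (0 : Fin 4) (2 : Fin 4)).1 (by decide))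
    exact hAv'' _ (h03 ▸ hright _ _ l23 h2) (aux' h03)
  · have h2 := hright _ _ l12 (hup _ _ l01 ((he' (1 : Fin 4) (0 : Fin 4)).1 (by decide)))
    have hd : π.perm (e (3 : Fin 4)) < π.perm (e (2 : Fin 4)) :=
      (he' (3 : Fin 4) (2 : Fin 4)).1 (by decide)
    have h03 := hmid _ _ (e (0 : Fin 4)) (hblk _ _ l23 h2 hd)
      ((he' (3 : Fin 4) (0 : Fin 4)).1 (by decide)) ((he' (0 : Fin 4) (2 : Fin 4)).1 (by decide))
    exact hAv'' _ (h03 ▸ hright _ _ l23 h2) (aux' h03)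
  · have h2 := hright _ _ l12 (hup _ _ l01 ((he' (1 : Fin 4) (0 : Fin 4)).1 (by decide)))
    have hd : π.perm (e (3 : Fin 4)) < π.perm (e (2 : Fin 4)) :=
      (he' (3 : Fin 4) (2 : Fin 4)).1 (by decide)
    have h03 := hmid _ _ (e (0 : Fin 4)) (hblk _ _ l23 h2 hd)
      ((he' (3 : Fin 4) (0 : Fin 4)).1 (by decide)) ((he' (0 : Fin 4) (2 : Fin 4)).1 (by decide))
    exact hAv'' _ (h03 ▸ hright _ _ l23 h2) (aux' h03)

/-! ### Decomposing a member of the class. -/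

theorem exists_isDirectSum_of_inversion {π : FinPerm} (hπ : π ∈ Av {p2431, p3142, p3241})
    {M : Fin π.len} (hM : ∀ p, p ≠ M → π.perm p < π.perm M) (hlast : (M : ℕ) + 1 < π.len)
    {a b : Fin π.len} (hab : a < b) (hbM : b ≤ M) (hinv : π.perm b < π.perm a) :
    ∃ σ τ, Contains π σ ∧ Contains π τ ∧ IsDirectSum π σ τ := by
  have hbelow : ∀ x y z, x < y → y ≤ M → π.perm y < π.perm x → M < z →
      π.perm x < π.perm z := by
    intro x y z hxy hyM hlt hz
    have hyM' : y < M := hyM.lt_of_ne fun h => absurd (hM x (h ▸ hxy.ne)) (h ▸ hlt).not_gt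
    by_contra! hzx
    have hzx' : π.perm z < π.perm x :=
      hzx.lt_of_ne fun h => ((hxy.trans hyM').trans hz).ne' (π.perm.injective h)
    have hxM := hM x (hxy.trans hyM').ne
    rcases lt_trichotomy (π.perm z) (π.perm y) with h | h | h
    · exact hπ p3241 (by simp) (contains_p3241 hxy hyM' hz h hlt hxM)
    · exact (hyM'.trans hz).ne' (π.perm.injective h)
    · exact hπ p3142 (by simp) (contains_p3142 hxy hyM' hz h hzx' hxM)
  -- The cut `t` is the leftmost position whose entry is not below everything after `M`.
  obtain ⟨t, ht, hmin⟩ := wellFounded_lt.has_min {p : Fin π.len | ∃ z, M < z ∧ π.perm z ≤ π.perm p}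
    ⟨M, ⟨(M : ℕ) + 1, hlast⟩, Nat.lt_succ_self _, (hM _ (Fin.ne_of_gt (Nat.lt_succ_self _))).le⟩
  obtain ⟨z, hz, hzt⟩ := ht
  have hlow : ∀ p, p < t → ∀ z, M < z → π.perm p < π.perm z := fun p hp z hz => by
    by_contra! h
    exact hmin p ⟨z, hz, h⟩ hp
  -- A later `q` below everything after `M` would form an inversion with `t`, forcing `t` below
  -- everything after `M` as well.
  have hhigh : ∀ q, t ≤ q → q ≤ M → ∃ z, M < z ∧ π.perm z ≤ π.perm q := fun q hq hqM => by
    by_contra! h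
    have hq' : t < q := hq.lt_of_ne fun h' => absurd (h z hz) (h' ▸ hzt).not_gt
    exact absurd (hbelow t q z hq' hqM ((h z hz).trans_le hzt) hz) hzt.not_gt
  have hat : a < t := by
    by_contra! h
    obtain ⟨z, hz, hza⟩ := hhigh a h (hab.le.trans hbM)
    exact absurd (hbelow a b z hab hbM hinv hz) hza.not_gt
  refine exists_isDirectSum t (Nat.zero_lt_of_lt hat) t.2 fun p q hp hq => ?_
  rcases le_or_gt q M with hqM | hqM
  · obtain ⟨z, hz, hzq⟩ := hhigh q hq hqM
    exact (hlow p hp z hz).trans_le hzq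
  · exact hlow p hp q hqM

theorem exists_isInflation_parallelAlternation {π : FinPerm} {M : Fin π.len}
    (hinc : ∀ p q, p < q → q ≤ M → π.perm p < π.perm q) (r : Fin π.len → Fin π.len)
    (hrM : ∀ q, M < q → r q ≤ M) (hr : ∀ q, M < q → π.perm q < π.perm (r q))
    (hr' : ∀ q, M < q → ∀ p, p < r q → π.perm p < π.perm q)
    (hmono : ∀ p q, M < p → p < q → r p ≤ r q)
    (h0 : ∃ q, M < q ∧ (r q : ℕ) = 0) (h1 : ∃ q, M < q ∧ (r q : ℕ) ≠ 0) :
    ∃ m : ℕ, 2 ≤ m ∧ ∃ α : Fin (parallelAlternation m).len → FinPerm,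
      (∀ i : Fin (parallelAlternation m).len, (i : ℕ) < m → IsIncreasing (α i)) ∧ (∀ i, Contains π (α i)) ∧
        IsInflation π (parallelAlternation m) α := by
  classical
  obtain ⟨q0, hq0, hr0⟩ := h0
  obtain ⟨q1, hq1, hr1⟩ := h1
  obtain ⟨R, hR⟩ : ∃ R : Finset ℕ, ∀ x, x ∈ R ↔ ∃ q, M < q ∧ (r q : ℕ) = x :=
    ⟨(Finset.Ioi M).image fun q => (r q : ℕ), fun x => by simp⟩
  have hrR : ∀ q, M < q → (r q : ℕ) ∈ R := fun q hq => (hR _).2 ⟨q, hq, rfl⟩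
  have hR0 : 0 ∈ R := hr0 ▸ hrR q0 hq0
  -- `R` is the set of cut points; `g x` counts those below `x` and numbers the blocks.
  obtain ⟨g, hg⟩ : ∃ g : ℕ → ℕ, g = Nat.count (· ∈ R) := ⟨_, rfl⟩
  have hg_mono : Monotone g := hg ▸ Nat.count_monotone _
  have hg_strict : ∀ x y, x ∈ R → x < y → g x < g y := fun x y hx hxy =>
    hg ▸ Nat.count_strict_mono hx hxy
  have hg_succ : ∀ x ∈ R, g (x + 1) = g x + 1 := fun x hx => by
    rw [hg, Nat.count_succ, if_pos hx]
  have hg_surj : ∀ i < R.card, ∃ x ∈ R, g x = i := fun i hi => by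
    have hi' : ∀ hf : (Set.ofPred (· ∈ R)).Finite, i < hf.toFinset.card := fun hf => by
      have : hf.toFinset = R := Finset.ext fun _ => hf.mem_toFinset
      exact this.symm ▸ hi
    exact ⟨_, Nat.nth_mem i hi', hg ▸ Nat.count_nth hi'⟩
  have hg_le : ∀ x, g x ≤ R.card := fun x => by
    rw [hg, Nat.count_eq_card_filter_range]
    refine Finset.card_le_card fun y hy => ?_
    exact (Finset.mem_filter.1 hy).2
  have hg_lt : ∀ x ∈ R, g x < R.card := fun x hx =>
    (hg_strict x _ hx (Nat.lt_succ_self x)).trans_le (hg_le _)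
  have hg_pos : ∀ x, 0 < g (x + 1) := fun x =>
    (Nat.zero_le _).trans_lt (hg_strict 0 (x + 1) hR0 (Nat.succ_pos x))
  -- A position up to `M` belongs to the last cut point at or before it, which exists because 0 is a
  -- cut point; a later `q` belongs to the cut point `r q`.
  obtain ⟨c, hcA, hcB⟩ : ∃ c : Fin π.len → Fin (parallelAlternation R.card).len,
      (∀ p, p ≤ M → (c p : ℕ) + 1 = g (p + 1)) ∧
        ∀ p, M < p → (c p : ℕ) = R.card + g (r p) := by
    have : ∀ p : Fin π.len, ∃ i : Fin (2 * R.card),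
        (p ≤ M → (i : ℕ) + 1 = g (p + 1)) ∧ (M < p → (i : ℕ) = R.card + g (r p)) := fun p => by
      rcases le_or_gt p M with hp | hp
      · have := hg_le (p + 1)
        have := hg_pos p
        exact ⟨⟨g (p + 1) - 1, by omega⟩, fun _ => Nat.sub_add_cancel (hg_pos p),
          fun h => absurd hp h.not_ge⟩
      · have := hg_lt _ (hrR p hp)
        exact ⟨⟨R.card + g (r p), by omega⟩, fun h => absurd hp h.not_gt, fun _ => rfl⟩
    choose c hc using this
    exact ⟨c, fun p => (hc p).1, fun p => (hc p).2⟩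
  have hcA' : ∀ p, p ≤ M → (c p : ℕ) < R.card := fun p hp => by
    have := hcA p hp
    have := hg_le (p + 1)
    omega
  have hcB' : ∀ p, M < p → R.card ≤ (c p : ℕ) := fun p hp => hcB p hp ▸ Nat.le_add_right _ _
  obtain ⟨α, hα, hαc, hαi⟩ := exists_isInflation (π := π) (σ := parallelAlternation R.card) c
    (fun i => by
      have hi : (i : ℕ) < 2 * R.card := i.2
      rcases lt_or_ge (i : ℕ) R.card with h | h
      · obtain ⟨x, hx, hgx⟩ := hg_surj i h
        obtain ⟨q, hq, rfl⟩ := (hR x).1 hx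
        refine ⟨r q, Fin.ext ?_⟩
        have := hcA _ (hrM q hq)
        have := hg_succ _ hx
        omega
      · obtain ⟨x, hx, hgx⟩ := hg_surj (i - R.card) (by omega)
        obtain ⟨q, hq, rfl⟩ := (hR x).1 hx
        refine ⟨q, Fin.ext ?_⟩
        have := hcB q hq
        omega)
    (fun p q hpq => by
      rw [Fin.le_def]
      rcases le_or_gt q M with hq | hq
      · have := hcA p (hpq.le.trans hq)
        have := hcA q hq
        have : g (p + 1) ≤ g (q + 1) := hg_mono (Nat.succ_le_succ hpq.le)
        omega
      · rcases le_or_gt p M with hp | hp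
        · exact (hcA' p hp).le.trans (hcB' q hq)
        · have : g (r p) ≤ g (r q) := hg_mono (hmono p q hp hpq)
          have := hcB p hp
          have := hcB q hq
          omega)
    (fun p q hpq => by
      rw [Fin.lt_def] at hpq
      rcases le_or_gt p M with hp | hp <;> rcases le_or_gt q M with hq | hq
      · rw [parallelAlternation_perm_of_lt (hcA' p hp),
          parallelAlternation_perm_of_lt (hcA' q hq)] at hpq
        have := hcA p hp
        have := hcA q hq
        have := hg_mono.reflect_lt (show g (p + 1) < g (q + 1) by omega)
        exact hinc p q (Nat.lt_of_succ_lt_succ this) hq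
      · rw [parallelAlternation_perm_of_lt (hcA' p hp),
          parallelAlternation_perm_of_le (hcB' q hq)] at hpq
        have := hcA p hp
        have := hcB q hq
        refine hr' q hq p ?_
        by_contra! h
        have := hg_strict _ (p + 1) (hrR q hq) (Nat.lt_succ_of_le h)
        omega
      · rw [parallelAlternation_perm_of_le (hcB' p hp),
          parallelAlternation_perm_of_lt (hcA' q hq)] at hpq
        have := hcB p hp
        have := hcA q hq
        have := hg_mono.reflect_lt (show g (r p) < g (q + 1) by omega)
        have hle : r p ≤ q := Nat.le_of_lt_succ this
        rcases hle.eq_or_lt with h | h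
        · exact h ▸ hr p hp
        · exact (hr p hp).trans (hinc _ _ h hq)
      · rw [parallelAlternation_perm_of_le (hcB' p hp),
          parallelAlternation_perm_of_le (hcB' q hq)] at hpq
        have := hcB p hp
        have := hcB q hq
        have := hg_mono.reflect_lt (show g (r p) < g (r q) by omega)
        exact (hr p hp).trans (hr' q hq _ this))
  refine ⟨R.card, Finset.one_lt_card.2 ⟨_, hR0, _, hrR q1 hq1, hr1.symm⟩, α,
    fun i hi => hαi i fun p q hpq _ hq => hinc p q hpq ?_, hαc, hα⟩
  by_contra! h
  have := hcB' q h
  rw [hq] at this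
  omega

theorem decomposition_of_mem_Av {π : FinPerm} (hlen : 2 ≤ π.len)
    (hπ : π ∈ Av {p2431, p3142, p3241}) :
    (∃ σ τ, Contains π σ ∧ Contains π τ ∧ IsDirectSum π σ τ) ∨
    (∃ σ τ, IsIncreasing σ ∧ Contains π τ ∧ IsSkewSum π σ τ) ∨
    (∃ m : ℕ, 2 ≤ m ∧ ∃ α : Fin (parallelAlternation m).len → FinPerm,
      (∀ i : Fin (parallelAlternation m).len, (i : ℕ) < m → IsIncreasing (α i)) ∧ (∀ i, Contains π (α i)) ∧
        IsInflation π (parallelAlternation m) α) := by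
  obtain ⟨M, hM⟩ : ∃ M, ∀ p, p ≠ M → π.perm p < π.perm M := by
    refine ⟨π.perm.symm ⟨π.len - 1, by omega⟩, fun p hp => ?_⟩
    rw [Equiv.apply_symm_apply]
    refine lt_of_le_of_ne (Nat.le_sub_one_of_lt (π.perm p).2) fun h => hp ?_
    rw [← h, Equiv.symm_apply_apply]
  by_cases hlast : (M : ℕ) + 1 = π.len
  · refine Or.inl (exists_isDirectSum M (by omega) M.2 fun p q hp hq => ?_)
    have : q = M := Fin.ext (by omega)
    exact this ▸ hM p (Fin.ne_of_lt hp)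
  have hlast' : (M : ℕ) + 1 < π.len := by omega
  by_cases hinc : ∀ p q, p < q → q ≤ M → π.perm p < π.perm q
  swap
  · push Not at hinc
    obtain ⟨a, b, hab, hb, hle⟩ := hinc
    exact Or.inl (exists_isDirectSum_of_inversion hπ hM hlast' hab hb
      (hle.lt_of_ne fun h => hab.ne' (π.perm.injective h)))
  have hfirst : ∀ q, M < q → ∃ p, p ≤ M ∧ π.perm q < π.perm p ∧
      ∀ p', p' < p → π.perm p' < π.perm q := fun q hq => by
    obtain ⟨p, hp, hmin⟩ := wellFounded_lt.has_min {p : Fin π.len | π.perm q < π.perm p}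
      ⟨M, hM q hq.ne'⟩
    have hpM : p ≤ M := not_lt.1 (hmin M (hM q hq.ne'))
    refine ⟨p, hpM, hp, fun p' hp' => lt_of_le_of_ne (not_lt.1 fun h => hmin p' h hp') fun h => ?_⟩
    exact ((hp'.trans_le hpM).trans hq).ne (π.perm.injective h)
  have : Nonempty (Fin π.len) := ⟨M⟩
  choose! r hrM hr hr' using hfirst
  have hmono : ∀ p q, M < p → p < q → r p ≤ r q := fun p q hp hpq => by
    by_contra! h
    have hq := hp.trans hpq
    -- The positions `r q`, `M`, `p`, `q` would form 2431.
    exact hπ p2431 (by simp) (contains_p2431 (h.trans_le (hrM p hp)) hp hpq (hr q hq)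
      (hr' p hp _ h) (hM p hp.ne'))
  by_cases h0 : ∃ q, M < q ∧ (r q : ℕ) = 0
  swap
  · push Not at h0
    refine Or.inl (exists_isDirectSum 1 one_pos (by omega) fun p q hp hq => ?_)
    rcases le_or_gt q M with h | h
    · exact hinc p q (Fin.lt_def.2 (lt_of_lt_of_le hp hq)) h
    · exact hr' q h p (Fin.lt_def.2 (lt_of_lt_of_le hp (Nat.pos_of_ne_zero (h0 q h))))
  by_cases h1 : ∃ q, M < q ∧ (r q : ℕ) ≠ 0
  · exact Or.inr (Or.inr
      (exists_isInflation_parallelAlternation hinc r hrM hr hr' hmono h0 h1))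
  · push Not at h1
    refine Or.inr (Or.inl (exists_isSkewSum (M + 1) (Nat.succ_pos _) hlast'
      (fun p q hp hq => ?_) fun p q hpq hq => hinc p q hpq (Nat.le_of_lt_succ hq)))
    have hle : r q ≤ p := Fin.le_def.2 (h1 q hq ▸ Nat.zero_le _)
    rcases hle.eq_or_lt with h | h
    · exact h ▸ hr q hq
    · exact (hr q hq).trans (hinc _ _ h (Nat.le_of_lt_succ hp))

theorem mem_Av_of_len_eq_one {π : FinPerm} (h : π.len = 1) : π ∈ Av {p2431, p3142, p3241} := by
  rintro β hβ ⟨e, he, -⟩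
  have hcard := Fintype.card_le_of_injective e he.injective
  rw [Fintype.card_fin, Fintype.card_fin, h] at hcard
  rcases hβ with rfl | rfl | rfl <;> exact absurd hcard (by decide)

end PermPattern

theorem mainTheorem3 (π : PermPattern.FinPerm) (hπ : 0 < π.len) :
    π ∈ PermPattern.Av {PermPattern.p2431, PermPattern.p3142, PermPattern.p3241} ↔
      π.len = 1 ∨
      (∃ σ ∈ PermPattern.Av {PermPattern.p2431, PermPattern.p3142, PermPattern.p3241},
        ∃ τ ∈ PermPattern.Av {PermPattern.p2431, PermPattern.p3142, PermPattern.p3241},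
          PermPattern.IsDirectSum π σ τ) ∨
      (∃ σ ∈ PermPattern.Av {PermPattern.p132, PermPattern.p213},
        ∃ τ ∈ PermPattern.Av {PermPattern.p2431, PermPattern.p3142, PermPattern.p3241},
          PermPattern.IsSkewSum π σ τ) ∨
      (∃ m : ℕ, 2 ≤ m ∧
        ∃ α : Fin (PermPattern.parallelAlternation m).len → PermPattern.FinPerm,
          (∀ i, Even (((PermPattern.parallelAlternation m).perm i : ℕ) + 1) →
            PermPattern.IsIncreasing (α i)) ∧
          (∀ i, Odd (((PermPattern.parallelAlternation m).perm i : ℕ) + 1) →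
            α i ∈ PermPattern.Av
              {PermPattern.p2431, PermPattern.p3142, PermPattern.p3241}) ∧
          PermPattern.IsInflation π (PermPattern.parallelAlternation m) α) := by
  constructor
  · intro h
    by_cases hlen : π.len = 1
    · exact Or.inl hlen
    refine Or.inr ?_
    rcases PermPattern.decomposition_of_mem_Av (by omega) h with
      ⟨σ, τ, hσ, hτ, hs⟩ | ⟨σ, τ, hσ, hτ, hs⟩ | ⟨m, hm, α, hinc, hα, hs⟩
    · exact Or.inl ⟨σ, PermPattern.mem_Av_of_contains h hσ, τ, PermPattern.mem_Av_of_contains h hτ, hs⟩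
    · exact Or.inr (Or.inl ⟨σ, hσ.mem_Av, τ, PermPattern.mem_Av_of_contains h hτ, hs⟩)
    · exact Or.inr (Or.inr ⟨m, hm, α, fun i hi => hinc i ((PermPattern.even_parallelAlternation_iff i).1 hi),
        fun i _ => PermPattern.mem_Av_of_contains h (hα i), hs⟩)
  · rintro (h | ⟨σ, hσ, τ, hτ, hs⟩ | ⟨σ, hσ, τ, hτ, hs⟩ | ⟨m, -, α, hinc, hAv, hs⟩)
    · exact PermPattern.mem_Av_of_len_eq_one h
    · exact PermPattern.mem_Av_of_isDirectSum hσ hτ hs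
    · exact PermPattern.mem_Av_of_isSkewSum hσ hτ hs
    · exact PermPattern.mem_Av_of_isInflation_parallelAlternation hinc hAv hs
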